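/- Let $m\in\mathbb R$ be a constant and let $M\subset\mathbb R^5$ be the set of points $(\eta,u,r,\theta,\phi)=(x^1,\dots,x^5)$ with $\eta\neq0$, $r\neq 0$, $\sin\theta\neq0$, with the semi-Riemannian metric $$ds^2=\eta^2\Big[d\eta^2-\Big(1-\frac{2m}{r}\Big)du^2-2\,du\,dr+r^2\big(d\theta^2+\sin^2\theta\,d\phi^2\big)\Big].$$ Let $\Gamma^a_{bc}$ be the Christoffel symbols of its Levi-Civita connection, and put $n=5$, $$R_{abcd}=g_{a\alpha}\big(\partial_d\Gamma^\alpha_{bc}-\partial_c\Gamma^\alpha_{bd}+\Gamma^\beta_{bc}\Gamma^\alpha_{\beta d}-\Gamma^\beta_{bd}\Gamma^\alpha_{\beta c}\big),\quad S_{ab}=g^{\alpha\beta}R_{\alpha ab\beta},\quad \kappa=g^{ab}S_{ab},$$ $$C=R+\frac{\kappa}{2(n-1)(n-2)}\,g\wedge g-\frac1{n-2}\,g\wedge S\quad\text{(the Weyl conformal curvature tensor)},$$ where $(D\wedge E)_{abcd}=D_{ad}E_{bc}+D_{bc}E_{ad}-D_{ac}E_{bd}-D_{bd}E_{ac}$.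 For a $(0,k)$-tensor $U$ let $$(C\cdot U)_{i_1\cdots i_kab}=-g^{\alpha\beta}\big[C_{abi_1\alpha}U_{\beta i_2\cdots i_k}+\cdots+C_{abi_k\alpha}U_{i_1\cdots i_{k-1}\beta}\big].$$ Then $M$ is Ricci semisymmetric due to the Weyl tensor, i.e. $C\cdot S=0$ on $M$. If $m\neq0$, then $C\cdot R\neq0$; in fact $C\cdot R$ is nonzero at every point of $M$. Moreover the tensor $A=C\cdot R$ has the symmetries $A_{abcdef}=-A_{bacdef}=-A_{abdcef}=A_{cdabef}=-A_{abcdfe}$, and (for every $m$) $$A_{233424}=-\frac{3m^2\eta^2}{r^4}=-A_{232434},\qquad A_{233525}=-\frac{3m^2\eta^2\sin^2\theta}{r^4}=-A_{232535},$$ $$A_{354524}=-A_{344525}=-\frac{3m^2\eta^2\sin^2\theta}{r^2}=A_{254534}=-A_{244535},$$ $$A_{254524}=\frac{3m^2(2m-r)\eta^2\sin^2\theta}{r^3}=-A_{244525},$$ while every component of $A$ that is not obtained from these ten by the symmetries above vanishes. -/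

import Mathlib

noncomputable section

open scoped ContDiff

/-- Components of a covariant tensor of type `(0, k)` at a point of an `n`-dimensional chart. -/
abbrev CovTensor (n k : ℕ) : Type := (Fin k → Fin n) → ℝ

/-- A semi-Riemannian metric (of arbitrary signature) on an open set of `ℝⁿ`, given by its matrix
of components in the coordinates of `ℝⁿ`. -/
structure SemiRiemannianChart (n : ℕ) where
  domain : Set (Fin n → ℝ)
  isOpen_domain : IsOpen domain
  metric : (Fin n → ℝ) → Matrix (Fin n) (Fin n) ℝ
  contDiffOn_metric : ∀ a b, ContDiffOn ℝ ∞ (fun x => metric x a b) domain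
  isSymm_metric : ∀ x ∈ domain, (metric x).IsSymm
  det_metric_ne_zero : ∀ x ∈ domain, (metric x).det ≠ 0

/-- The partial derivative `∂f/∂xᵃ` at `x`. -/
def partialDeriv {n : ℕ} (a : Fin n) (f : (Fin n → ℝ) → ℝ) (x : Fin n → ℝ) : ℝ :=
  deriv (fun t => f (Function.update x a t)) (x a)

/-- The Kulkarni-Nomizu product of two `(0, 2)` tensors. -/
def kulkarniNomizu {n : ℕ} (D E : CovTensor n 2) : CovTensor n 4 := fun i =>
  D ![i 0, i 3] * E ![i 1, i 2] + D ![i 1, i 2] * E ![i 0, i 3]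
    - D ![i 0, i 2] * E ![i 1, i 3] - D ![i 1, i 3] * E ![i 0, i 2]

namespace SemiRiemannianChart

variable {n : ℕ} (M : SemiRiemannianChart n)

/-- The components `gᵃᵇ` of the inverse metric. -/
def inverseMetric (x : Fin n → ℝ) : Matrix (Fin n) (Fin n) ℝ := (M.metric x)⁻¹

/-- The metric as a `(0, 2)` tensor. -/
def metricTensor (x : Fin n → ℝ) : CovTensor n 2 := fun i => M.metric x (i 0) (i 1)

/-- The Christoffel symbols of the second kind `Γᵃ_{bc}` of the Levi-Civita connection. -/
def christoffel (a b c : Fin n) (x : Fin n → ℝ) : ℝ :=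
  (1 / 2) * ∑ α, M.inverseMetric x a α *
    (partialDeriv b (fun y => M.metric y α c) x + partialDeriv c (fun y => M.metric y α b) x
      - partialDeriv α (fun y => M.metric y b c) x)

/-- The Riemann curvature tensor
`R_{abcd} = g_{aα} (∂_d Γ^α_{bc} - ∂_c Γ^α_{bd} + Γ^β_{bc} Γ^α_{βd} - Γ^β_{bd} Γ^α_{βc})`. -/
def riemann (x : Fin n → ℝ) : CovTensor n 4 := fun i =>
  ∑ α, M.metric x (i 0) α *
    (partialDeriv (i 3) (M.christoffel α (i 1) (i 2)) x
      - partialDeriv (i 2) (M.christoffel α (i 1) (i 3)) x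
      + ∑ β, (M.christoffel β (i 1) (i 2) x * M.christoffel α β (i 3) x
          - M.christoffel β (i 1) (i 3) x * M.christoffel α β (i 2) x))

/-- The Ricci tensor `S_{ab} = g^{αβ} R_{αabβ}`. -/
def ricci (x : Fin n → ℝ) : CovTensor n 2 := fun i =>
  ∑ α, ∑ β, M.inverseMetric x α β * M.riemann x ![α, i 0, i 1, β]

/-- The scalar curvature `κ = g^{ab} S_{ab}`. -/
def scalarCurvature (x : Fin n → ℝ) : ℝ :=
  ∑ a, ∑ b, M.inverseMetric x a b * M.ricci x ![a, b]

/-- The Weyl conformal curvature tensor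
`C = R + κ / (2 (n - 1) (n - 2)) (g ∧ g) - 1 / (n - 2) (g ∧ S)` (for `n ≥ 3`). -/
def weyl (x : Fin n → ℝ) : CovTensor n 4 := fun i =>
  M.riemann x i
    + M.scalarCurvature x / (2 * ((n : ℝ) - 1) * ((n : ℝ) - 2)) *
        kulkarniNomizu (M.metricTensor x) (M.metricTensor x) i
    - 1 / ((n : ℝ) - 2) * kulkarniNomizu (M.metricTensor x) (M.ricci x) i

/-- The `(0, k + 2)` tensor `L · U`, for a `(0, 4)` tensor `L` and a `(0, k)` tensor `U` at `x`:
`(L · U)_{i₁ … i_k a b} = - g^{αβ} (L_{a b i₁ α} U_{β i₂ … i_k} + … + L_{a b i_k α} U_{i₁ … β})`. -/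
def curvatureAction {k : ℕ} (x : Fin n → ℝ) (L : CovTensor n 4) (U : CovTensor n k) :
    CovTensor n (k + 2) := fun i =>
  -∑ α, ∑ β, M.inverseMetric x α β *
    ∑ j : Fin k, L ![i (Fin.natAdd k 0), i (Fin.natAdd k 1), i (Fin.castAdd 2 j), α] *
      U (Function.update (fun l => i (Fin.castAdd 2 l)) j β)

/-- The `(0, 4)` tensor `C · S`. -/
def weylDotRicci (x : Fin n → ℝ) : CovTensor n 4 :=
  M.curvatureAction x (M.weyl x) (M.ricci x)

/-- The `(0, 6)` tensor `C · R`. -/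
def weylDotRiemann (x : Fin n → ℝ) : CovTensor n 6 :=
  M.curvatureAction x (M.weyl x) (M.riemann x)

/-- Ricci semisymmetric due to the Weyl tensor: `C · S = 0`. -/
def IsRicciSemisymmetricDueToWeyl : Prop := ∀ x ∈ M.domain, M.weylDotRicci x = 0

/-- Semisymmetric due to the Weyl tensor: `C · R = 0`. -/
def IsSemisymmetricDueToWeyl : Prop := ∀ x ∈ M.domain, M.weylDotRiemann x = 0

end SemiRiemannianChart

/-- The matrix of
`η² (dη² - (1 - 2m/r) du² - 2 du dr + r² (dθ² + sin² θ dφ²))`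
in the coordinates `x = (η, u, r, θ, φ)`. -/
def schwarzschildImmersionMatrix (m : ℝ) (x : Fin 5 → ℝ) : Matrix (Fin 5) (Fin 5) ℝ :=
  x 0 ^ 2 •
    !![1, 0, 0, 0, 0;
       0, -(1 - 2 * m / x 2), -1, 0, 0;
       0, -1, 0, 0, 0;
       0, 0, 0, x 2 ^ 2, 0;
       0, 0, 0, 0, x 2 ^ 2 * Real.sin (x 3) ^ 2]

theorem det_schwarzschildImmersionMatrix (m : ℝ) (x : Fin 5 → ℝ) :
    (schwarzschildImmersionMatrix m x).det = -x 0 ^ 10 * x 2 ^ 4 * Real.sin (x 3) ^ 2 := by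
  simp [schwarzschildImmersionMatrix, Matrix.det_succ_row_zero, Fin.sum_univ_succ,
    Fin.succAbove, Matrix.submatrix]
  ring

/-- The immersion of the Schwarzschild metric (in outgoing Eddington-Finkelstein coordinates) in a
5-dimensional semi-Riemannian space, with coordinates `x = (η, u, r, θ, φ)`, on the set of all
points of `ℝ⁵` where its metric is defined and nondegenerate. -/
def schwarzschildImmersion (m : ℝ) : SemiRiemannianChart 5 where
  domain := {x | x 0 ≠ 0 ∧ x 2 ≠ 0 ∧ Real.sin (x 3) ≠ 0}
  isOpen_domain := by
    refine IsOpen.inter ?_ (IsOpen.inter ?_ ?_)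
    · exact isOpen_ne_fun (by fun_prop) (by fun_prop)
    · exact isOpen_ne_fun (by fun_prop) (by fun_prop)
    · exact isOpen_ne_fun (by fun_prop) (by fun_prop)
  metric := schwarzschildImmersionMatrix m
  contDiffOn_metric := by
    intro a b
    have h : ∀ x ∈ {x : Fin 5 → ℝ | x 0 ≠ 0 ∧ x 2 ≠ 0 ∧ Real.sin (x 3) ≠ 0}, x 2 ≠ 0 :=
      fun x hx => hx.2.1
    fin_cases a <;> fin_cases b <;> simp [schwarzschildImmersionMatrix] <;>
      fun_prop
  isSymm_metric := by
    intro x _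
    ext a b
    fin_cases a <;> fin_cases b <;> simp [schwarzschildImmersionMatrix]
  det_metric_ne_zero := by
    rintro x ⟨h0, h2, h3⟩
    rw [det_schwarzschildImmersionMatrix]
    exact mul_ne_zero (mul_ne_zero (neg_ne_zero.2 (pow_ne_zero _ h0)) (pow_ne_zero _ h2))
      (pow_ne_zero _ h3)

end

/-! Write `g = η² (dη² + h + s)`, with `h` the `(u, r)` block and `s` the sphere block. The metric
is conformal to the product of a line and Ricci-flat Schwarzschild space, so its Weyl tensor is that
of the Schwarzschild factor, rescaled: `W = η² (m / r³) (h ∧ h + s ∧ s - h ∧ s)`. A coordinate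
computation gives `R = W - g ∧ g / (2 η⁴) + (2 / η²) g ∧ dη²` (`riemann_eq`), whence `S = -(2 / η⁴)
g + (6 / η²) dη²` and `C = W` (`weyl_eq`).

The operation `U ↦ C · U` is linear and obeys the Leibniz rule for `∧` (`actFour_knComp`). It kills
`g`, and it kills `dη²` because `W` has no `η` components; so `C · S = 0`, and only `W` contributes
to `C · R`. On the blocks, `C · h = (m / r³) M = -C · s` for an explicit tensor `M` (`mixedComp`).
The Leibniz rule then yields `C · R = (3 m² η² / r⁶) (h ∧ M - s ∧ M)` (`weylDotRiemann_eq`), from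
which components and symmetries are read off. -/

theorem forall_fin_five {P : Fin 5 → Prop} : (∀ i, P i) ↔ P 0 ∧ P 1 ∧ P 2 ∧ P 3 ∧ P 4 := by
  simp [Fin.forall_fin_succ]

-- Closed forms of the Christoffel symbols are available only on the open domain; agreement near the
-- point suffices to differentiate them.
open Filter Topology in
theorem partialDeriv_congr {n : ℕ} {f g : (Fin n → ℝ) → ℝ} {x : Fin n → ℝ} (h : f =ᶠ[𝓝 x] g)
    (a : Fin n) : partialDeriv a f x = partialDeriv a g x := by
  refine EventuallyEq.deriv_eq ?_
  have hc : Tendsto (fun t => Function.update x a t) (𝓝 (x a)) (𝓝 x) := by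
    have : Continuous fun t => Function.update x a t := by fun_prop
    simpa using this.tendsto (x a)
  exact hc.eventually h

/-- The Kulkarni-Nomizu product in terms of components. -/
def knComp {n : ℕ} (D E : Fin n → Fin n → ℝ) (a b c d : Fin n) : ℝ :=
  D a d * E b c + D b c * E a d - D a c * E b d - D b d * E a c

theorem knComp_swap_left {n : ℕ} (D E : Fin n → Fin n → ℝ) (a b c d : Fin n) :
    knComp D E b a c d = -knComp D E a b c d := by
  simp only [knComp]
  ring

theorem knComp_swap_right {n : ℕ} (D E : Fin n → Fin n → ℝ) (a b c d : Fin n) :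
    knComp D E a b d c = -knComp D E a b c d := by
  simp only [knComp]
  ring

theorem knComp_swap_pairs {n : ℕ} {D E : Fin n → Fin n → ℝ} (hD : ∀ a b, D a b = D b a)
    (hE : ∀ a b, E a b = E b a) (a b c d : Fin n) : knComp D E c d a b = knComp D E a b c d := by
  simp only [knComp, hD c, hD d, hE c, hE d]
  ring

/-! ### The derivation action on tensors of type `(0, 2)` and `(0, 4)` -/

section Action

variable {n : ℕ}

/-- The components of `-g^{αβ} (L_{e f a α} D_{β b} + L_{e f b α} D_{a β})`. -/
def actTwo (G : Fin n → Fin n → ℝ) (L : Fin n → Fin n → Fin n → Fin n → ℝ)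
    (D : Fin n → Fin n → ℝ) (e f a b : Fin n) : ℝ :=
  -∑ α, ∑ β, G α β * (L e f a α * D β b + L e f b α * D a β)

/-- The analogue of `actTwo` for tensors of type `(0, 4)`. -/
def actFour (G : Fin n → Fin n → ℝ) (L : Fin n → Fin n → Fin n → Fin n → ℝ)
    (U : Fin n → Fin n → Fin n → Fin n → ℝ) (a b c d e f : Fin n) : ℝ :=
  -∑ α, ∑ β, G α β * (L e f a α * U β b c d + L e f b α * U a β c d + L e f c α * U a b β d
    + L e f d α * U a b c β)

variable {G : Fin n → Fin n → ℝ} {L : Fin n → Fin n → Fin n → Fin n → ℝ}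

theorem actTwo_add (D E : Fin n → Fin n → ℝ) (e f a b : Fin n) :
    actTwo G L (fun i j => D i j + E i j) e f a b = actTwo G L D e f a b + actTwo G L E e f a b := by
  simp only [actTwo, ← neg_add, ← Finset.sum_add_distrib]
  congr! 3
  ring

theorem actTwo_smul (c : ℝ) (D : Fin n → Fin n → ℝ) (e f a b : Fin n) :
    actTwo G L (fun i j => c * D i j) e f a b = c * actTwo G L D e f a b := by
  simp only [actTwo, mul_neg, Finset.mul_sum]
  congr! 3
  ring

theorem actFour_add (U V : Fin n → Fin n → Fin n → Fin n → ℝ) (a b c d e f : Fin n) :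
    actFour G L (fun i j k l => U i j k l + V i j k l) a b c d e f =
      actFour G L U a b c d e f + actFour G L V a b c d e f := by
  simp only [actFour, ← neg_add, ← Finset.sum_add_distrib]
  congr! 3
  ring

theorem actFour_smul (r : ℝ) (U : Fin n → Fin n → Fin n → Fin n → ℝ) (a b c d e f : Fin n) :
    actFour G L (fun i j k l => r * U i j k l) a b c d e f = r * actFour G L U a b c d e f := by
  simp only [actFour, mul_neg, Finset.mul_sum]
  congr! 3
  ring

/-- Leibniz rule: each index belongs to exactly one factor of each product. No symmetry of `G`, `L`,
`D` or `E` is needed. -/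
theorem actFour_knComp (D E : Fin n → Fin n → ℝ) (a b c d e f : Fin n) :
    actFour G L (knComp D E) a b c d e f =
      knComp (actTwo G L D e f) E a b c d + knComp D (actTwo G L E e f) a b c d := by
  simp only [knComp, actFour, actTwo, neg_mul, mul_neg, Finset.mul_sum, Finset.sum_mul,
    ← Finset.sum_neg_distrib, ← Finset.sum_add_distrib, ← Finset.sum_sub_distrib]
  congr! 2
  ring

end Action

/-! ### Metric, connection and their derivatives in coordinates -/

namespace schwarzschildImmersion

/-- The components of the metric. -/
noncomputable def metricComp (m : ℝ) (x : Fin 5 → ℝ) : Fin 5 → Fin 5 → ℝ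
  | 0, 0 => x 0 ^ 2
  | 1, 1 => -(x 0 ^ 2 * (1 - 2 * m / x 2))
  | 1, 2 => -x 0 ^ 2
  | 2, 1 => -x 0 ^ 2
  | 3, 3 => x 0 ^ 2 * x 2 ^ 2
  | 4, 4 => x 0 ^ 2 * (x 2 ^ 2 * Real.sin (x 3) ^ 2)
  | _, _ => 0

/-- The components of the inverse metric. -/
noncomputable def inverseComp (m : ℝ) (x : Fin 5 → ℝ) : Fin 5 → Fin 5 → ℝ
  | 0, 0 => (x 0 ^ 2)⁻¹
  | 1, 2 => -(x 0 ^ 2)⁻¹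
  | 2, 1 => -(x 0 ^ 2)⁻¹
  | 2, 2 => (x 0 ^ 2)⁻¹ * (1 - 2 * m / x 2)
  | 3, 3 => (x 0 ^ 2)⁻¹ * (x 2 ^ 2)⁻¹
  | 4, 4 => (x 0 ^ 2)⁻¹ * (x 2 ^ 2 * Real.sin (x 3) ^ 2)⁻¹
  | _, _ => 0

/-- The partial derivatives `∂g_{ab}/∂xᵈ`, as a function of `d, a, b`. -/
noncomputable def metricDeriv (m : ℝ) (x : Fin 5 → ℝ) : Fin 5 → Fin 5 → Fin 5 → ℝ
  | 0, a, b => match a, b with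
    | 0, 0 => 2 * x 0
    | 1, 1 => -(2 * x 0 * (1 - 2 * m / x 2))
    | 1, 2 => -(2 * x 0)
    | 2, 1 => -(2 * x 0)
    | 3, 3 => 2 * x 0 * x 2 ^ 2
    | 4, 4 => 2 * x 0 * (x 2 ^ 2 * Real.sin (x 3) ^ 2)
    | _, _ => 0
  | 2, a, b => match a, b with
    | 1, 1 => -(x 0 ^ 2 * (2 * m / x 2 ^ 2))
    | 3, 3 => x 0 ^ 2 * (2 * x 2)
    | 4, 4 => x 0 ^ 2 * (2 * x 2 * Real.sin (x 3) ^ 2)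
    | _, _ => 0
  | 3, a, b => match a, b with
    | 4, 4 => x 0 ^ 2 * (x 2 ^ 2 * (2 * Real.sin (x 3) * Real.cos (x 3)))
    | _, _ => 0
  | _, _, _ => 0

/-- The Christoffel symbols `Γᵃ_{bc}`. -/
noncomputable def connection (m : ℝ) (x : Fin 5 → ℝ) : Fin 5 → Fin 5 → Fin 5 → ℝ
  | 0, b, c => match b, c with
    | 0, 0 => (x 0)⁻¹
    | 1, 1 => (1 - 2 * m / x 2) * (x 0)⁻¹
    | 1, 2 => (x 0)⁻¹
    | 2, 1 => (x 0)⁻¹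
    | 3, 3 => -(x 2 ^ 2 * (x 0)⁻¹)
    | 4, 4 => -(x 2 ^ 2 * Real.sin (x 3) ^ 2 * (x 0)⁻¹)
    | _, _ => 0
  | 1, b, c => match b, c with
    | 0, 1 => (x 0)⁻¹
    | 1, 0 => (x 0)⁻¹
    | 1, 1 => -(m / x 2 ^ 2)
    | 3, 3 => x 2
    | 4, 4 => x 2 * Real.sin (x 3) ^ 2
    | _, _ => 0
  | 2, b, c => match b, c with
    | 0, 2 => (x 0)⁻¹
    | 2, 0 => (x 0)⁻¹
    | 1, 1 => m / x 2 ^ 2 - 2 * m ^ 2 / x 2 ^ 3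
    | 1, 2 => m / x 2 ^ 2
    | 2, 1 => m / x 2 ^ 2
    | 3, 3 => 2 * m - x 2
    | 4, 4 => (2 * m - x 2) * Real.sin (x 3) ^ 2
    | _, _ => 0
  | 3, b, c => match b, c with
    | 0, 3 => (x 0)⁻¹
    | 3, 0 => (x 0)⁻¹
    | 2, 3 => (x 2)⁻¹
    | 3, 2 => (x 2)⁻¹
    | 4, 4 => -(Real.sin (x 3) * Real.cos (x 3))
    | _, _ => 0
  | 4, b, c => match b, c with
    | 0, 4 => (x 0)⁻¹
    | 4, 0 => (x 0)⁻¹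
    | 2, 4 => (x 2)⁻¹
    | 4, 2 => (x 2)⁻¹
    | 3, 4 => Real.cos (x 3) / Real.sin (x 3)
    | 4, 3 => Real.cos (x 3) / Real.sin (x 3)
    | _, _ => 0

/-- The partial derivatives `∂Γᵃ_{bc}/∂xᵈ`, as a function of `d, a, b, c`. -/
noncomputable def connectionDeriv (m : ℝ) (x : Fin 5 → ℝ) :
    Fin 5 → Fin 5 → Fin 5 → Fin 5 → ℝ
  | 0, a, b, c => match a, b, c with
    | 0, 0, 0 => -(x 0 ^ 2)⁻¹
    | 0, 1, 1 => -((1 - 2 * m / x 2) * (x 0 ^ 2)⁻¹)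
    | 0, 1, 2 => -(x 0 ^ 2)⁻¹
    | 0, 2, 1 => -(x 0 ^ 2)⁻¹
    | 0, 3, 3 => x 2 ^ 2 * (x 0 ^ 2)⁻¹
    | 0, 4, 4 => x 2 ^ 2 * Real.sin (x 3) ^ 2 * (x 0 ^ 2)⁻¹
    | 1, 0, 1 => -(x 0 ^ 2)⁻¹
    | 1, 1, 0 => -(x 0 ^ 2)⁻¹
    | 2, 0, 2 => -(x 0 ^ 2)⁻¹
    | 2, 2, 0 => -(x 0 ^ 2)⁻¹
    | 3, 0, 3 => -(x 0 ^ 2)⁻¹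
    | 3, 3, 0 => -(x 0 ^ 2)⁻¹
    | 4, 0, 4 => -(x 0 ^ 2)⁻¹
    | 4, 4, 0 => -(x 0 ^ 2)⁻¹
    | _, _, _ => 0
  | 2, a, b, c => match a, b, c with
    | 0, 1, 1 => 2 * m / x 2 ^ 2 * (x 0)⁻¹
    | 0, 3, 3 => -(2 * x 2 * (x 0)⁻¹)
    | 0, 4, 4 => -(2 * x 2 * Real.sin (x 3) ^ 2 * (x 0)⁻¹)
    | 1, 1, 1 => 2 * m / x 2 ^ 3
    | 1, 3, 3 => 1
    | 1, 4, 4 => Real.sin (x 3) ^ 2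
    | 2, 1, 1 => -(2 * m / x 2 ^ 3) + 6 * m ^ 2 / x 2 ^ 4
    | 2, 1, 2 => -(2 * m / x 2 ^ 3)
    | 2, 2, 1 => -(2 * m / x 2 ^ 3)
    | 2, 3, 3 => -1
    | 2, 4, 4 => -Real.sin (x 3) ^ 2
    | 3, 2, 3 => -(x 2 ^ 2)⁻¹
    | 3, 3, 2 => -(x 2 ^ 2)⁻¹
    | 4, 2, 4 => -(x 2 ^ 2)⁻¹
    | 4, 4, 2 => -(x 2 ^ 2)⁻¹
    | _, _, _ => 0
  | 3, a, b, c => match a, b, c with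
    | 0, 4, 4 => -(x 2 ^ 2 * (2 * Real.sin (x 3) * Real.cos (x 3)) * (x 0)⁻¹)
    | 1, 4, 4 => x 2 * (2 * Real.sin (x 3) * Real.cos (x 3))
    | 2, 4, 4 => (2 * m - x 2) * (2 * Real.sin (x 3) * Real.cos (x 3))
    | 3, 4, 4 => Real.sin (x 3) ^ 2 - Real.cos (x 3) ^ 2
    | 4, 3, 4 => -1 - (Real.cos (x 3) / Real.sin (x 3)) ^ 2
    | 4, 4, 3 => -1 - (Real.cos (x 3) / Real.sin (x 3)) ^ 2
    | _, _, _ => 0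
  | _, _, _, _ => 0

variable {m : ℝ} {x : Fin 5 → ℝ}

theorem metric_eq (a b : Fin 5) :
    (schwarzschildImmersion m).metric x a b = metricComp m x a b := by
  revert a b
  simp only [forall_fin_five, metricComp]
  simp [schwarzschildImmersion, schwarzschildImmersionMatrix]
  ring

theorem inverseMetric_eq (hx : x ∈ (schwarzschildImmersion m).domain) (a b : Fin 5) :
    (schwarzschildImmersion m).inverseMetric x a b = inverseComp m x a b := by
  obtain ⟨h0, h2, h3⟩ := hx
  suffices h : (schwarzschildImmersion m).inverseMetric x = Matrix.of (inverseComp m x) by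
    rw [h, Matrix.of_apply]
  refine Matrix.inv_eq_right_inv ?_
  ext a b
  revert a b
  simp only [Matrix.mul_apply, metric_eq, Matrix.of_apply, Fin.sum_univ_five, Matrix.one_apply]
  simp only [forall_fin_five, metricComp, inverseComp, mul_zero, zero_mul, add_zero, zero_add]
  simp
  field_simp
  simp

theorem partialDeriv_metric (hx : x ∈ (schwarzschildImmersion m).domain) (d a b : Fin 5) :
    partialDeriv d (fun y => (schwarzschildImmersion m).metric y a b) x =
      metricDeriv m x d a b := by
  obtain ⟨h0, h2, h3⟩ := hx
  have hf : HasDerivAt (fun t : ℝ => 2 * m / t) (-(2 * m / x 2 ^ 2)) (x 2) := by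
    simpa [div_eq_mul_inv] using (hasDerivAt_inv h2).const_mul (2 * m)
  revert d a b
  simp only [metric_eq, partialDeriv]
  simp only [forall_fin_five, metricDeriv, metricComp]
  simp [hf.deriv]

/-- Collapses the sparse sums before the split into components, which keeps the case analysis small.
-/
theorem sum_inverseComp_mul (v : Fin 5 → ℝ) (a : Fin 5) :
    ∑ α, inverseComp m x a α * v α = (match a with
      | 0 => (x 0 ^ 2)⁻¹ * v 0
      | 1 => (x 0 ^ 2)⁻¹ * -v 2
      | 2 => (x 0 ^ 2)⁻¹ * (-v 1 + (1 - 2 * m / x 2) * v 2)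
      | 3 => (x 0 ^ 2)⁻¹ * ((x 2 ^ 2)⁻¹ * v 3)
      | 4 => (x 0 ^ 2)⁻¹ * ((x 2 ^ 2 * Real.sin (x 3) ^ 2)⁻¹ * v 4)) := by
  simp only [Fin.sum_univ_five]
  revert a
  simp only [forall_fin_five, inverseComp]
  refine ⟨?_, ?_, ?_, ?_, ?_⟩ <;> ring

set_option maxHeartbeats 1000000 in
theorem christoffel_eq (hx : x ∈ (schwarzschildImmersion m).domain) (a b c : Fin 5) :
    (schwarzschildImmersion m).christoffel a b c x = connection m x a b c := by
  simp only [SemiRiemannianChart.christoffel, inverseMetric_eq hx, partialDeriv_metric hx,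
    sum_inverseComp_mul]
  obtain ⟨h0, h2, h3⟩ := hx
  revert a b c
  simp only [forall_fin_five, metricDeriv, connection, mul_zero, add_zero,
    zero_add, sub_zero, zero_sub, sub_self, neg_zero, true_and, and_true]
  repeat' apply And.intro
  all_goals field_simp
  all_goals ring

set_option maxHeartbeats 2000000 in
theorem partialDeriv_connection (hx : x ∈ (schwarzschildImmersion m).domain) (d a b c : Fin 5) :
    partialDeriv d (fun y => connection m y a b c) x = connectionDeriv m x d a b c := by
  obtain ⟨h0, h2, h3⟩ := hx
  have inv_pow (k : ℕ) (c : ℝ) : deriv (fun t => c / t ^ (k + 1)) (x 2) =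
      -(((k + 1 : ℕ) : ℝ) * c / x 2 ^ (k + 2)) := by
    have h := (((hasDerivAt_id (x 2)).pow (k + 1)).inv (pow_ne_zero _ h2)).const_mul c
    refine (HasDerivAt.deriv (h.congr_of_eventuallyEq (.of_forall fun t => ?_))).trans ?_
    · simp [div_eq_mul_inv]
    · simp only [Pi.pow_apply, id, add_tsub_cancel_right]
      field_simp
      ring
  have diff_inv_pow (k : ℕ) (c : ℝ) : DifferentiableAt ℝ (fun t => c / t ^ k) (x 2) := by
    fun_prop (disch := exact pow_ne_zero _ h2)
  have inv_pow_one (c : ℝ) : deriv (fun t => c / t) (x 2) = -(c / x 2 ^ 2) := by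
    simpa using inv_pow 0 c
  have inv_pow_two (c : ℝ) : deriv (fun t => c / t ^ 2) (x 2) = -(2 * c / x 2 ^ 3) := by
    simpa using inv_pow 1 c
  have inv_pow_three (c : ℝ) : deriv (fun t => c / t ^ 3) (x 2) = -(3 * c / x 2 ^ 4) := by
    simpa using inv_pow 2 c
  have sin_sq (t : ℝ) : deriv (fun t => Real.sin t ^ 2) t = 2 * Real.sin t * Real.cos t := by
    simp
  have sin_mul_cos (t : ℝ) : deriv (fun t => -(Real.sin t * Real.cos t)) t =
      Real.sin t ^ 2 - Real.cos t ^ 2 := by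
    refine (((Real.hasDerivAt_sin t).mul (Real.hasDerivAt_cos t)).neg.deriv).trans ?_
    ring
  have cot : deriv (fun t => Real.cos t / Real.sin t) (x 3) =
      -1 - (Real.cos (x 3) / Real.sin (x 3)) ^ 2 := by
    refine (((Real.hasDerivAt_cos (x 3)).div (Real.hasDerivAt_sin (x 3)) h3).deriv).trans ?_
    field_simp
  have update_ne : ∀ i j : Fin 5, i ≠ j → ∀ t, Function.update x j t i = x i :=
    fun i j h t => Function.update_of_ne h t x
  revert d a b c
  simp only [partialDeriv]
  simp only [forall_fin_five, connection, connectionDeriv, Function.update_self, deriv_const,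
    true_and, and_true, ne_eq, Fin.reduceEq, not_false_eq_true, update_ne]
  simp only [deriv_mul_const_field', deriv_const_mul_field', deriv.fun_neg', deriv_const_sub,
    inv_pow_one, inv_pow_two, sin_sq, sin_mul_cos, cot, deriv_inv, deriv_id'',
    deriv_fun_sub (diff_inv_pow 2 _) (diff_inv_pow 3 _), inv_pow_three]
  repeat' apply And.intro
  all_goals first | rfl | (simp; try ring)

/-! ### Block decomposition of the metric and its curvature -/

/-- The components of `dη²`. -/
def radialComp : Fin 5 → Fin 5 → ℝ
  | 0, 0 => 1
  | _, _ => 0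

/-- The components of the `(u, r)` block of the metric divided by `η²`. -/
noncomputable def orbitComp (m : ℝ) (x : Fin 5 → ℝ) : Fin 5 → Fin 5 → ℝ
  | 1, 1 => -(1 - 2 * m / x 2)
  | 1, 2 => -1
  | 2, 1 => -1
  | _, _ => 0

/-- The components of the `(θ, φ)` block of the metric divided by `η²`. -/
noncomputable def sphereComp (x : Fin 5 → ℝ) : Fin 5 → Fin 5 → ℝ
  | 3, 3 => x 2 ^ 2
  | 4, 4 => x 2 ^ 2 * Real.sin (x 3) ^ 2
  | _, _ => 0

theorem metricComp_eq (a b : Fin 5) :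
    metricComp m x a b = x 0 ^ 2 * (radialComp a b + orbitComp m x a b + sphereComp x a b) := by
  revert a b
  simp only [forall_fin_five, metricComp, radialComp, orbitComp, sphereComp]
  simp
  ring

theorem sum_metricComp_mul (v : Fin 5 → ℝ) (a : Fin 5) :
    ∑ α, metricComp m x a α * v α = x 0 ^ 2 * (match a with
      | 0 => v 0
      | 1 => -((1 - 2 * m / x 2) * v 1) - v 2
      | 2 => - v 1
      | 3 => x 2 ^ 2 * v 3
      | 4 => x 2 ^ 2 * Real.sin (x 3) ^ 2 * v 4) := by
  simp only [Fin.sum_univ_five]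
  revert a
  simp only [forall_fin_five, metricComp]
  refine ⟨?_, ?_, ?_, ?_, ?_⟩ <;> ring

/-- The components of the trace-free part of the curvature. -/
noncomputable def weylComp (m : ℝ) (x : Fin 5 → ℝ) (a b c d : Fin 5) : ℝ :=
  x 0 ^ 2 * (m / x 2 ^ 3) * (knComp (orbitComp m x) (orbitComp m x) a b c d
    + knComp (sphereComp x) (sphereComp x) a b c d - knComp (orbitComp m x) (sphereComp x) a b c d)

theorem riemann_apply (hx : x ∈ (schwarzschildImmersion m).domain) (a b c d : Fin 5) :
    (schwarzschildImmersion m).riemann x ![a, b, c, d] =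
      ∑ α, metricComp m x a α *
        (connectionDeriv m x d α b c - connectionDeriv m x c α b d
          + ∑ β, (connection m x β b c * connection m x α β d
            - connection m x β b d * connection m x α β c)) := by
  have hd (e p q r : Fin 5) :
      partialDeriv e ((schwarzschildImmersion m).christoffel p q r) x =
        connectionDeriv m x e p q r := by
    rw [← partialDeriv_connection hx]
    refine partialDeriv_congr ?_ _
    filter_upwards [(schwarzschildImmersion m).isOpen_domain.mem_nhds hx] with y hy
    exact christoffel_eq hy p q r
  simp [SemiRiemannianChart.riemann, hd, christoffel_eq hx, metric_eq]

set_option maxHeartbeats 4000000 in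
theorem riemann_eq_of_lt (hx : x ∈ (schwarzschildImmersion m).domain) (c d : Fin 5) (hcd : c < d)
    (a b : Fin 5) :
    (schwarzschildImmersion m).riemann x ![a, b, c, d] =
      weylComp m x a b c d
        - (knComp (metricComp m x) (metricComp m x) a b c d / (2 * x 0 ^ 4)
          - 2 / x 0 ^ 2 * knComp (metricComp m x) radialComp a b c d) := by
  rw [riemann_apply hx, sum_metricComp_mul]
  obtain ⟨h0, h2, h3⟩ := hx
  revert c d
  simp only [forall_fin_five, Fin.reduceLT, forall_const, true_and, and_true,
    IsEmpty.forall_iff, Fin.not_lt_zero, lt_self_iff_false]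
  refine ⟨⟨?_, ?_, ?_, ?_⟩, ⟨?_, ?_, ?_⟩, ⟨?_, ?_⟩, ?_⟩
  all_goals
    revert a b
    simp only [Fin.sum_univ_five, forall_fin_five, connection, connectionDeriv, weylComp, knComp,
      metricComp, radialComp, orbitComp, sphereComp, mul_zero, zero_mul, add_zero, zero_add,
      sub_zero, zero_sub, sub_self, neg_zero, true_and, and_true, zero_div]
    repeat' apply And.intro
  all_goals (field_simp; try ring)

theorem riemann_eq (hx : x ∈ (schwarzschildImmersion m).domain) (a b c d : Fin 5) :
    (schwarzschildImmersion m).riemann x ![a, b, c, d] =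
      weylComp m x a b c d
        - (knComp (metricComp m x) (metricComp m x) a b c d / (2 * x 0 ^ 4)
          - 2 / x 0 ^ 2 * knComp (metricComp m x) radialComp a b c d) := by
  -- Antisymmetry in the last two indices is visible in the defining formula, so the component check
  -- is needed only for `c < d`.
  have swap (c d : Fin 5) : (schwarzschildImmersion m).riemann x ![a, b, d, c] =
      -(schwarzschildImmersion m).riemann x ![a, b, c, d] := by
    simp only [riemann_apply hx, ← Finset.sum_neg_distrib, Finset.sum_sub_distrib]
    congr! 1
    ring
  rcases lt_trichotomy c d with h | rfl | h
  · exact riemann_eq_of_lt hx c d h a b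
  · have h0 : (schwarzschildImmersion m).riemann x ![a, b, c, c] = 0 := by linarith [swap c c]
    rw [h0]
    simp only [weylComp, knComp]
    ring
  · rw [swap, riemann_eq_of_lt hx d c h a b]
    simp only [weylComp, knComp]
    ring

theorem sum_sum_inverseComp_mul (D : Fin 5 → Fin 5 → ℝ) :
    ∑ α, ∑ β, inverseComp m x α β * D α β =
      (x 0 ^ 2)⁻¹ * (D 0 0 - D 1 2 - D 2 1 + (1 - 2 * m / x 2) * D 2 2 + (x 2 ^ 2)⁻¹ * D 3 3
        + (x 2 ^ 2 * Real.sin (x 3) ^ 2)⁻¹ * D 4 4) := by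
  simp only [inverseComp, Fin.sum_univ_five]
  ring

/-- The mass drops out because `W` is trace-free: the traces of `h ∧ h + s ∧ s` and of `h ∧ s` are
both proportional to `h + s`, and they cancel. -/
theorem ricci_eq (hx : x ∈ (schwarzschildImmersion m).domain) (a b : Fin 5) :
    (schwarzschildImmersion m).ricci x ![a, b] =
      -(2 / x 0 ^ 4) * metricComp m x a b + 6 / x 0 ^ 2 * radialComp a b := by
  have h : (schwarzschildImmersion m).ricci x ![a, b] = ∑ α, ∑ β, inverseComp m x α β *
      (schwarzschildImmersion m).riemann x ![α, a, b, β] := by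
    simp [SemiRiemannianChart.ricci, inverseMetric_eq hx]
  rw [h, sum_sum_inverseComp_mul]
  clear h
  simp only [riemann_eq hx]
  obtain ⟨h0, h2, h3⟩ := hx
  revert a b
  simp only [forall_fin_five, weylComp, knComp,
    metricComp, radialComp, orbitComp, sphereComp, mul_zero, zero_mul, add_zero, zero_add,
    sub_zero, zero_sub, sub_self, neg_zero, true_and, and_true, zero_div]
  repeat' apply And.intro
  all_goals (field_simp; try ring)

theorem scalarCurvature_eq (hx : x ∈ (schwarzschildImmersion m).domain) :
    (schwarzschildImmersion m).scalarCurvature x = -(4 / x 0 ^ 4) := by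
  simp only [SemiRiemannianChart.scalarCurvature, inverseMetric_eq hx, ricci_eq hx,
    sum_sum_inverseComp_mul, metricComp, radialComp]
  obtain ⟨h0, h2, h3⟩ := hx
  field_simp
  ring

/-- For `n = 5` the coefficients of `g ∧ g / η⁴` add up to `-1/2 - 1/6 + 2/3 = 0`, and those of `g ∧
dη² / η²` to `2 - 2 = 0`. -/
theorem weyl_eq (hx : x ∈ (schwarzschildImmersion m).domain) (a b c d : Fin 5) :
    (schwarzschildImmersion m).weyl x ![a, b, c, d] = weylComp m x a b c d := by
  simp only [SemiRiemannianChart.weyl, scalarCurvature_eq hx, riemann_eq hx, kulkarniNomizu,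
    SemiRiemannianChart.metricTensor, metric_eq, Matrix.cons_val, Matrix.cons_val_zero,
    Matrix.cons_val_one, ricci_eq hx, knComp]
  have h0 := hx.1
  push_cast
  field_simp
  ring

/-! ### Contractions of the blocks and the action of `C` on them -/

/-- With an index raised, `h` is `η⁻²` times the projection onto the `(u, r)` plane; likewise `s`
for the sphere directions, and the projections onto different blocks compose to zero. -/
theorem contract_orbit_orbit (a b : Fin 5) :
    ∑ α, ∑ β, inverseComp m x α β * (orbitComp m x a α * orbitComp m x β b) =
      (x 0 ^ 2)⁻¹ * orbitComp m x a b := by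
  rw [sum_sum_inverseComp_mul]
  revert a b
  simp only [forall_fin_five, orbitComp]
  ring_nf
  simp

theorem contract_sphere_sphere (hx : x ∈ (schwarzschildImmersion m).domain) (a b : Fin 5) :
    ∑ α, ∑ β, inverseComp m x α β * (sphereComp x a α * sphereComp x β b) =
      (x 0 ^ 2)⁻¹ * sphereComp x a b := by
  rw [sum_sum_inverseComp_mul]
  obtain ⟨h0, h2, h3⟩ := hx
  revert a b
  simp only [forall_fin_five, sphereComp]
  field_simp
  simp
  ring

theorem contract_orbit_sphere (a b : Fin 5) :
    ∑ α, ∑ β, inverseComp m x α β * (orbitComp m x a α * sphereComp x β b) = 0 := by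
  rw [sum_sum_inverseComp_mul]
  revert a b
  simp [sphereComp, orbitComp]

theorem contract_sphere_orbit (a b : Fin 5) :
    ∑ α, ∑ β, inverseComp m x α β * (sphereComp x a α * orbitComp m x β b) = 0 := by
  rw [sum_sum_inverseComp_mul]
  revert a b
  simp [sphereComp, orbitComp]

theorem contract_orbit_radial (a b : Fin 5) :
    ∑ α, ∑ β, inverseComp m x α β * (orbitComp m x a α * radialComp β b) = 0 := by
  rw [sum_sum_inverseComp_mul]
  revert a b
  simp [radialComp, orbitComp]

theorem contract_sphere_radial (a b : Fin 5) :
    ∑ α, ∑ β, inverseComp m x α β * (sphereComp x a α * radialComp β b) = 0 := by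
  rw [sum_sum_inverseComp_mul]
  revert a b
  simp [radialComp, sphereComp]

theorem orbitComp_comm (a b : Fin 5) : orbitComp m x a b = orbitComp m x b a := by
  revert a b
  simp [forall_fin_five, orbitComp]

theorem sphereComp_comm (a b : Fin 5) : sphereComp x a b = sphereComp x b a := by
  revert a b
  simp [forall_fin_five, sphereComp]

theorem radialComp_comm (a b : Fin 5) : radialComp a b = radialComp b a := by
  revert a b
  simp [forall_fin_five, radialComp]

theorem contract_weylComp (D : Fin 5 → Fin 5 → ℝ) (e f i k : Fin 5) :
    ∑ α, ∑ β, inverseComp m x α β * (weylComp m x e f i α * D β k) =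
      x 0 ^ 2 * (m / x 2 ^ 3) *
        ((2 * orbitComp m x f i - sphereComp x f i) *
            ∑ α, ∑ β, inverseComp m x α β * (orbitComp m x e α * D β k)
          - (2 * orbitComp m x e i - sphereComp x e i) *
            ∑ α, ∑ β, inverseComp m x α β * (orbitComp m x f α * D β k)
          + (2 * sphereComp x f i - orbitComp m x f i) *
            ∑ α, ∑ β, inverseComp m x α β * (sphereComp x e α * D β k)
          - (2 * sphereComp x e i - orbitComp m x e i) *
            ∑ α, ∑ β, inverseComp m x α β * (sphereComp x f α * D β k)) := by
  simp only [Finset.mul_sum, ← Finset.sum_add_distrib, ← Finset.sum_sub_distrib]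
  congr! 2
  simp only [weylComp, knComp]
  ring

theorem actTwo_of_comm {D : Fin 5 → Fin 5 → ℝ} (hD : ∀ a b, D a b = D b a) (e f a b : Fin 5) :
    actTwo (inverseComp m x) (weylComp m x) D e f a b =
      -(∑ α, ∑ β, inverseComp m x α β * (weylComp m x e f a α * D β b)
        + ∑ α, ∑ β, inverseComp m x α β * (weylComp m x e f b α * D β a)) := by
  simp only [actTwo, mul_add, Finset.sum_add_distrib, hD a]

theorem actTwo_radialComp :
    actTwo (inverseComp m x) (weylComp m x) radialComp = fun _ _ _ _ => 0 := by
  ext e f a b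
  simp [actTwo_of_comm radialComp_comm, contract_weylComp, contract_orbit_radial,
    contract_sphere_radial]

/-- The components of the tensor proportional to `C · h`, where `h` is the `(u, r)` block. -/
noncomputable def mixedComp (m : ℝ) (x : Fin 5 → ℝ) (e f a b : Fin 5) : ℝ :=
  orbitComp m x e b * sphereComp x f a + orbitComp m x e a * sphereComp x f b
    - orbitComp m x f b * sphereComp x e a - orbitComp m x f a * sphereComp x e b

/-- The `h h` terms cancel on symmetrizing in `a, b`; only the cross term `-h ∧ s` of `W` survives.
-/
theorem actTwo_orbitComp (hx : x ∈ (schwarzschildImmersion m).domain) :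
    actTwo (inverseComp m x) (weylComp m x) (orbitComp m x) =
      fun e f a b => m / x 2 ^ 3 * mixedComp m x e f a b := by
  ext e f a b
  have h0 := hx.1
  simp only [actTwo_of_comm orbitComp_comm, contract_weylComp, contract_orbit_orbit,
    contract_sphere_orbit, mixedComp]
  field_simp
  ring

theorem actTwo_sphereComp (hx : x ∈ (schwarzschildImmersion m).domain) :
    actTwo (inverseComp m x) (weylComp m x) (sphereComp x) =
      fun e f a b => -(m / x 2 ^ 3 * mixedComp m x e f a b) := by
  ext e f a b
  have h0 := hx.1
  simp only [actTwo_of_comm sphereComp_comm, contract_weylComp, contract_sphere_sphere hx,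
    contract_orbit_sphere, mixedComp]
  field_simp
  ring

theorem actTwo_metricComp (hx : x ∈ (schwarzschildImmersion m).domain) :
    actTwo (inverseComp m x) (weylComp m x) (metricComp m x) = fun _ _ _ _ => 0 := by
  ext e f a b
  have h : metricComp m x = fun a b => x 0 ^ 2 * ((radialComp a b + orbitComp m x a b)
      + sphereComp x a b) := by
    ext a b
    exact metricComp_eq a b
  rw [h, actTwo_smul, actTwo_add, actTwo_add, actTwo_radialComp, actTwo_orbitComp hx,
    actTwo_sphereComp hx]
  ring

/-! ### The tensors `C · S` and `C · R` -/

theorem weylDotRicci_eq_zero (hx : x ∈ (schwarzschildImmersion m).domain) :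
    (schwarzschildImmersion m).weylDotRicci x = 0 := by
  have key (a b e f : Fin 5) :
      (schwarzschildImmersion m).weylDotRicci x ![a, b, e, f] = 0 := by
    have h : (schwarzschildImmersion m).weylDotRicci x ![a, b, e, f] =
        actTwo (inverseComp m x) (weylComp m x) (fun i j => -(2 / x 0 ^ 4) * metricComp m x i j
          + 6 / x 0 ^ 2 * radialComp i j) e f a b := by
      have h0 (β : Fin 5) : (Function.update (fun l => ![a, b, e, f] (Fin.castAdd 2 l)) 0 β :
          Fin 2 → Fin 5) = ![β, b] := by
        ext l; fin_cases l <;> rfl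
      have h1 (β : Fin 5) : (Function.update (fun l => ![a, b, e, f] (Fin.castAdd 2 l)) 1 β :
          Fin 2 → Fin 5) = ![a, β] := by
        ext l; fin_cases l <;> rfl
      simp only [SemiRiemannianChart.weylDotRicci, SemiRiemannianChart.curvatureAction,
        Fin.sum_univ_two, h0, h1, weyl_eq hx, ricci_eq hx, inverseMetric_eq hx]
      rfl
    rw [h, actTwo_add, actTwo_smul, actTwo_smul, actTwo_metricComp hx, actTwo_radialComp]
    ring
  ext i
  have hi : i = ![i 0, i 1, i 2, i 3] := by
    ext l; fin_cases l <;> rfl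
  rw [hi, key]
  rfl

theorem weylDotRiemann_eq (hx : x ∈ (schwarzschildImmersion m).domain) (a b c d e f : Fin 5) :
    (schwarzschildImmersion m).weylDotRiemann x ![a, b, c, d, e, f] =
      3 * m ^ 2 * x 0 ^ 2 / x 2 ^ 6 *
        (knComp (orbitComp m x) (mixedComp m x e f) a b c d
          - knComp (sphereComp x) (mixedComp m x e f) a b c d) := by
  have h : (schwarzschildImmersion m).weylDotRiemann x ![a, b, c, d, e, f] =
      actFour (inverseComp m x) (weylComp m x) (fun i j k l =>
        (schwarzschildImmersion m).riemann x ![i, j, k, l]) a b c d e f := by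
    have hU (j : Fin 4) (β : Fin 5) :
        (Function.update (fun l => ![a, b, c, d, e, f] (Fin.castAdd 2 l)) j β : Fin 4 → Fin 5) =
          Function.update ![a, b, c, d] j β := by
      congr 1
      ext l; fin_cases l <;> rfl
    have h0 (β : Fin 5) : Function.update ![a, b, c, d] 0 β = ![β, b, c, d] := by
      ext l; fin_cases l <;> rfl
    have h1 (β : Fin 5) : Function.update ![a, b, c, d] 1 β = ![a, β, c, d] := by
      ext l; fin_cases l <;> rfl
    have h2 (β : Fin 5) : Function.update ![a, b, c, d] 2 β = ![a, b, β, d] := by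
      ext l; fin_cases l <;> rfl
    have h3 (β : Fin 5) : Function.update ![a, b, c, d] 3 β = ![a, b, c, β] := by
      ext l; fin_cases l <;> rfl
    simp only [SemiRiemannianChart.weylDotRiemann, SemiRiemannianChart.curvatureAction,
      Fin.sum_univ_four, hU, h0, h1, h2, h3, weyl_eq hx, inverseMetric_eq hx]
    rfl
  -- Sums with scalars in front are the shape that `actFour_add` and `actFour_smul` match.
  have hR : (fun i j k l => (schwarzschildImmersion m).riemann x ![i, j, k, l]) =
      fun i j k l => ((x 0 ^ 2 * (m / x 2 ^ 3) *
        knComp (orbitComp m x) (orbitComp m x) i j k l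
        + x 0 ^ 2 * (m / x 2 ^ 3) * knComp (sphereComp x) (sphereComp x) i j k l)
        + -(x 0 ^ 2 * (m / x 2 ^ 3)) * knComp (orbitComp m x) (sphereComp x) i j k l)
        + (-(1 / (2 * x 0 ^ 4)) * knComp (metricComp m x) (metricComp m x) i j k l
        + 2 / x 0 ^ 2 * knComp (metricComp m x) radialComp i j k l) := by
    ext i j k l
    rw [riemann_eq hx, weylComp]
    ring
  rw [h, hR]
  simp only [actFour_add, actFour_smul, actFour_knComp, actTwo_metricComp hx,
    actTwo_radialComp, actTwo_orbitComp hx, actTwo_sphereComp hx]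
  simp only [knComp]
  ring

/-! ### Symmetries and vanishing components -/

theorem mixedComp_zero_left (f a b : Fin 5) : mixedComp m x 0 f a b = 0 := by
  simp [mixedComp, orbitComp, sphereComp]

/-- Each term of `M` needs one of `e, f` in the orbit block and the other in the sphere block. -/
theorem mixedComp_one_two (a b : Fin 5) : mixedComp m x 1 2 a b = 0 := by
  revert a b
  simp [mixedComp, orbitComp, sphereComp]

theorem mixedComp_three_four (a b : Fin 5) : mixedComp m x 3 4 a b = 0 := by
  revert a b
  simp [mixedComp, orbitComp, sphereComp]

theorem mixedComp_comm (e f a b : Fin 5) : mixedComp m x e f a b = mixedComp m x e f b a := by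
  simp only [mixedComp]
  ring

theorem mixedComp_swap (e f a b : Fin 5) : mixedComp m x f e a b = -mixedComp m x e f a b := by
  simp only [mixedComp]
  ring

theorem eq_pair_of_lt : ∀ a b : Fin 5, a < b →
    a = 0 ∧ b = 1 ∨ a = 0 ∧ b = 2 ∨ a = 0 ∧ b = 3 ∨ a = 0 ∧ b = 4 ∨ a = 1 ∧ b = 2 ∨
    a = 1 ∧ b = 3 ∨ a = 1 ∧ b = 4 ∨ a = 2 ∧ b = 3 ∨ a = 2 ∧ b = 4 ∨ a = 3 ∧ b = 4 := by
  decide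

set_option maxHeartbeats 4000000 in
theorem knComp_mixedComp_eq_zero (a b c d e f : Fin 5) (hab : a < b) (hcd : c < d) (hef : e < f)
    (h : a < c ∨ (a = c ∧ b ≤ d))
    (hmem : ![a, b, c, d, e, f] ∉ ({![1, 2, 2, 3, 1, 3], ![1, 2, 1, 3, 2, 3],
            ![1, 2, 2, 4, 1, 4], ![1, 2, 1, 4, 2, 4], ![2, 4, 3, 4, 1, 3], ![2, 3, 3, 4, 1, 4],
            ![1, 4, 3, 4, 2, 3], ![1, 3, 3, 4, 2, 4], ![1, 4, 3, 4, 1, 3],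
            ![1, 3, 3, 4, 1, 4]} : Set (Fin 6 → Fin 5))) :
    knComp (orbitComp m x) (mixedComp m x e f) a b c d
      - knComp (sphereComp x) (mixedComp m x e f) a b c d = 0 := by
  rcases eq_pair_of_lt e f hef with ⟨rfl, rfl⟩ | ⟨rfl, rfl⟩ | ⟨rfl, rfl⟩ | ⟨rfl, rfl⟩ | ⟨rfl, rfl⟩ |
    ⟨rfl, rfl⟩ | ⟨rfl, rfl⟩ | ⟨rfl, rfl⟩ | ⟨rfl, rfl⟩ | ⟨rfl, rfl⟩
  -- The first branch disposes of every `(e, f)` not joining `{1, 2}` to `{3, 4}`. In the rest, a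
  -- choice of pairs is out of order, vanishes termwise, cancels algebraically, or is one of the ten
  -- excluded.
  all_goals first
    | simp only [knComp, mixedComp_zero_left, mixedComp_one_two, mixedComp_three_four, mul_zero,
        add_zero, sub_zero]
      done
    | rcases eq_pair_of_lt a b hab with ⟨rfl, rfl⟩ | ⟨rfl, rfl⟩ | ⟨rfl, rfl⟩ | ⟨rfl, rfl⟩ |
        ⟨rfl, rfl⟩ | ⟨rfl, rfl⟩ | ⟨rfl, rfl⟩ | ⟨rfl, rfl⟩ | ⟨rfl, rfl⟩ | ⟨rfl, rfl⟩ <;>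
      rcases eq_pair_of_lt c d hcd with ⟨rfl, rfl⟩ | ⟨rfl, rfl⟩ | ⟨rfl, rfl⟩ | ⟨rfl, rfl⟩ |
        ⟨rfl, rfl⟩ | ⟨rfl, rfl⟩ | ⟨rfl, rfl⟩ | ⟨rfl, rfl⟩ | ⟨rfl, rfl⟩ | ⟨rfl, rfl⟩ <;>
      first
        | exact absurd h (by decide)
        | (simp only [knComp, mixedComp, orbitComp, sphereComp, mul_zero, zero_mul, add_zero,
            zero_add, sub_zero, zero_sub, sub_self]; done)
        | (simp only [knComp, mixedComp, orbitComp, sphereComp]; ring1)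
        | exact absurd (by simp) hmem

end schwarzschildImmersion

open schwarzschildImmersion in
/-- Coordinates are `x = (η, u, r, θ, φ) = (x 0, x 1, x 2, x 3, x 4)`, so the index `i` of the usual
numbering `1, …, 5` is `i - 1` here; for instance `A ![1, 2, 2, 3, 1, 3]` is `A_{233424}`. -/
theorem mainTheorem2 (m : ℝ) :
    (schwarzschildImmersion m).IsRicciSemisymmetricDueToWeyl ∧
    (m ≠ 0 → ¬ (schwarzschildImmersion m).IsSemisymmetricDueToWeyl) ∧
    ∀ x ∈ (schwarzschildImmersion m).domain,
      ∀ η r θ : ℝ, η = x 0 → r = x 2 → θ = x 3 →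
      ∀ A : CovTensor 5 6, A = (schwarzschildImmersion m).weylDotRiemann x →
        -- at every point the tensor `C · R` is nonzero
        (m ≠ 0 → A ≠ 0) ∧
        -- the listed components
        A ![1, 2, 2, 3, 1, 3] = -(3 * m ^ 2 * η ^ 2 / r ^ 4) ∧
        A ![1, 2, 1, 3, 2, 3] = 3 * m ^ 2 * η ^ 2 / r ^ 4 ∧
        A ![1, 2, 2, 4, 1, 4] = -(3 * m ^ 2 * η ^ 2 * Real.sin θ ^ 2 / r ^ 4) ∧
        A ![1, 2, 1, 4, 2, 4] = 3 * m ^ 2 * η ^ 2 * Real.sin θ ^ 2 / r ^ 4 ∧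
        A ![2, 4, 3, 4, 1, 3] = -(3 * m ^ 2 * η ^ 2 * Real.sin θ ^ 2 / r ^ 2) ∧
        A ![2, 3, 3, 4, 1, 4] = 3 * m ^ 2 * η ^ 2 * Real.sin θ ^ 2 / r ^ 2 ∧
        A ![1, 4, 3, 4, 2, 3] = -(3 * m ^ 2 * η ^ 2 * Real.sin θ ^ 2 / r ^ 2) ∧
        A ![1, 3, 3, 4, 2, 4] = 3 * m ^ 2 * η ^ 2 * Real.sin θ ^ 2 / r ^ 2 ∧
        A ![1, 4, 3, 4, 1, 3] = 3 * m ^ 2 * (2 * m - r) * η ^ 2 * Real.sin θ ^ 2 / r ^ 3 ∧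
        A ![1, 3, 3, 4, 1, 4] = -(3 * m ^ 2 * (2 * m - r) * η ^ 2 * Real.sin θ ^ 2 / r ^ 3) ∧
        -- the symmetries up to which components are listed
        (∀ a b c d e f : Fin 5,
          A ![b, a, c, d, e, f] = -A ![a, b, c, d, e, f] ∧
          A ![a, b, d, c, e, f] = -A ![a, b, c, d, e, f] ∧
          A ![c, d, a, b, e, f] = A ![a, b, c, d, e, f] ∧
          A ![a, b, c, d, f, e] = -A ![a, b, c, d, e, f]) ∧
        -- up to these symmetries all other components vanish
        (∀ a b c d e f : Fin 5, a < b → c < d → e < f → (a < c ∨ (a = c ∧ b ≤ d)) →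
          ![a, b, c, d, e, f] ∉ ({![1, 2, 2, 3, 1, 3], ![1, 2, 1, 3, 2, 3],
            ![1, 2, 2, 4, 1, 4], ![1, 2, 1, 4, 2, 4], ![2, 4, 3, 4, 1, 3], ![2, 3, 3, 4, 1, 4],
            ![1, 4, 3, 4, 2, 3], ![1, 3, 3, 4, 2, 4], ![1, 4, 3, 4, 1, 3],
            ![1, 3, 3, 4, 1, 4]} : Set (Fin 6 → Fin 5)) →
          A ![a, b, c, d, e, f] = 0) := by
  have nonzero : ∀ x ∈ (schwarzschildImmersion m).domain, m ≠ 0 →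
      (schwarzschildImmersion m).weylDotRiemann x ≠ 0 := by
    intro x hx hm h0
    -- This component equals `-3 m² η² / r⁴`, which has no zero on the domain when `m ≠ 0`.
    have h := weylDotRiemann_eq hx 1 2 2 3 1 3
    obtain ⟨hη, hr, -⟩ := hx
    rw [h0] at h
    simp [knComp, mixedComp, orbitComp, sphereComp, hm, hη, hr] at h
  refine ⟨fun x hx => weylDotRicci_eq_zero hx, fun hm h => ?_, ?_⟩
  -- Any point would do; the domain only has to be nonempty.
  · have hx : ![1, 0, 1, Real.pi / 2, 0] ∈ (schwarzschildImmersion m).domain := by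
      simp [schwarzschildImmersion]
    exact nonzero _ hx hm (h _ hx)
  · rintro x hx η r θ rfl rfl rfl A rfl
    refine ⟨nonzero x hx, ?_, ?_, ?_, ?_, ?_, ?_, ?_, ?_, ?_, ?_, fun a b c d e f => ?_,
      fun a b c d e f hab hcd hef h hmem => ?_⟩
    iterate 10
      · have hr := hx.2.1
        rw [weylDotRiemann_eq hx]
        simp only [knComp, mixedComp, orbitComp, sphereComp]
        field_simp
        ring
    · simp only [weylDotRiemann_eq hx, knComp_swap_left _ _ a b, knComp_swap_right _ _ a b c d,
        knComp_swap_pairs orbitComp_comm (mixedComp_comm e f) a b c d,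
        knComp_swap_pairs sphereComp_comm (mixedComp_comm e f) a b c d]
      refine ⟨by ring, by ring, trivial, ?_⟩
      -- The indices `e, f` enter only through `M`, which is antisymmetric in them.
      simp only [knComp, mixedComp_swap e f]
      ring
    · rw [weylDotRiemann_eq hx, knComp_mixedComp_eq_zero a b c d e f hab hcd hef h hmem, mul_zero]
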